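/- Consider a discrete-time linear time-invariant single-input single-output system with nonzero proper transfer function $\mathsf G(z)$ of minimal order $n$ (the smallest state dimension of a realization of $\mathsf G$), relative degree $\nu$ (degree of the denominator minus degree of the numerator in lowest terms), and lag $l$ (the observability index of a minimal realization). For $k\ge 1$ let $\mathcal W_k\subset\mathbb R^{2k}$ be the set of all length-$k$ input-output trajectories $\mathrm{col}(u,y)$ of the system, i.e. of a minimal realization of $\mathsf G$ with arbitrary initial state (or, equivalently, of any possibly non-minimal state-space model with the same input-output trajectories). For $L\ge 0$ let $\mathcal W_k^L$ be the set of all $\mathrm{col}(u,y)$ with $u\in\mathbb R^k$, $y\in\mathbb R^{k+L}$ such that $\mathrm{col}(u,u',y)\in\mathcal W_{k+L}$ for some $u'\in\mathbb R^L$. Let $N\ge l$ and $L\ge\nu$, and let $U_{\mathrm p}\in\mathbb R^{N\times T}$, $U_{\mathrm f}\in\mathbb R^{1\times T}$, $Y_{\mathrm p}\in\mathbb R^{N\times T}$, $Y_{\mathrm f}^L\in\mathbb R^{(L+1)\times T}$ be data matrices such that every column of $$\overline{\mathrm H}_{\mathrm{inv}}=\begin{bmatrix}U_{\mathrm p}\\U_{\mathrm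 f}\\Y_{\mathrm p}\\Y_{\mathrm f}^L\end{bmatrix}$$ belongs to $\mathcal W_{N+1}^L$. Put $$\mathrm H_{\mathrm{inv}}=\begin{bmatrix}U_{\mathrm p}\\Y_{\mathrm p}\\Y_{\mathrm f}^L\end{bmatrix}.$$ Then $\operatorname{im}\overline{\mathrm H}_{\mathrm{inv}}=\mathcal W_{N+1}^L$ if and only if $\operatorname{rank}(\mathrm H_{\mathrm{inv}})=N+n+L-\nu+1$. In this case, let $(u(t),y(t))_{t\ge -N-L}$ be any input-output trajectory of the system, and consider the algorithm that at each time $t=0,1,2,\dots$ takes any solution $g(t)\in\mathbb R^T$ of $$\mathrm H_{\mathrm{inv}}\,g(t)=\begin{bmatrix}\hat u(t-N-L)\\ \vdots\\ \hat u(t-1-L)\\ y(t-N-L)\\ \vdots\\ y(t)\end{bmatrix}$$ and sets $\hat u(t-L)=U_{\mathrm f}\,g(t)$. If the algorithm is initialized with $\hat u(t-L)=u(t-L)$ for all $t\in\{-N,\dots,-1\}$, then a solution $g(t)$ exists at every step and, whichever solutions are chosen, $\hat u(t-L)=u(t-L)$ for all integers $t\ge 0$. -/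

import Mathlib

/-- A discrete-time linear time-invariant single-input single-output state-space system with `n`
states: `x(t+1) = A x(t) + B u(t)`, `y(t) = C x(t) + D u(t)`. The column `B` and the row `C` are
stored as vectors. -/
structure SISOSystem (n : ℕ) where
  A : Matrix (Fin n) (Fin n) ℝ
  B : Fin n → ℝ
  C : Fin n → ℝ
  D : ℝ

namespace SISOSystem

/-- The state and output equations at one time instant: `x` is the state, `x'` the next state. -/
def Step {n : ℕ} (S : SISOSystem n) (x : Fin n → ℝ) (u : ℝ) (x' : Fin n → ℝ) (y : ℝ) : Prop :=
  x' = Matrix.mulVec S.A x + u • S.B ∧ y = dotProduct S.C x + S.D * u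

/-- The transfer function `G(z) = C (z I - A)⁻¹ B + D`, a rational function of `z`. The matrix
`z I - A` is invertible over the field of rational functions. -/
noncomputable def transferFunction {n : ℕ} (S : SISOSystem n) : RatFunc ℝ :=
  dotProduct (fun i => RatFunc.C (S.C i))
    (Matrix.mulVec ((RatFunc.X : RatFunc ℝ) • (1 : Matrix (Fin n) (Fin n) (RatFunc ℝ))
        - S.A.map (fun a => RatFunc.C a))⁻¹ (fun i => RatFunc.C (S.B i)))
    + RatFunc.C S.D

/-- `S` is a minimal realization: no state-space system with the same transfer function has
fewer states. The number of states is then the minimal order of the transfer function. -/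
def IsMinimal {n : ℕ} (S : SISOSystem n) : Prop :=
  ∀ (m : ℕ) (S' : SISOSystem m), S'.transferFunction = S.transferFunction → n ≤ m

/-- The observability matrix with the `k` rows `C, C A, …, C A ^ (k - 1)`. -/
def obsMatrix {n : ℕ} (S : SISOSystem n) (k : ℕ) : Matrix (Fin k) (Fin n) ℝ :=
  Matrix.of fun i => Matrix.vecMul S.C (S.A ^ (i : ℕ))

/-- The observability index: the least `k` for which the observability matrix with `k` rows has
the same rank as the one with `n` rows. -/
noncomputable def obsIndex {n : ℕ} (S : SISOSystem n) : ℕ :=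
  sInf {k : ℕ | (S.obsMatrix k).rank = (S.obsMatrix n).rank}

/-- The set `W_k` of all input-output trajectories `col(u, y)` of length `k`, for arbitrary
initial states. -/
def trajectories {n : ℕ} (S : SISOSystem n) (k : ℕ) : Set (Fin k ⊕ Fin k → ℝ) :=
  {w | ∃ x : ℕ → Fin n → ℝ, ∀ i : Fin k,
    S.Step (x i) (w (Sum.inl i)) (x (i + 1)) (w (Sum.inr i))}

/-- The set `W_k^L` of all `col(u, y)` with `u` of length `k` and `y` of length `k + L` such that
`col(u, u', y)` is a trajectory of length `k + L` for some `u'` of length `L`. -/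
def delayTrajectories {n : ℕ} (S : SISOSystem n) (k L : ℕ) : Set (Fin k ⊕ Fin (k + L) → ℝ) :=
  {w | ∃ u' : Fin L → ℝ,
    Sum.elim (Fin.append (fun i => w (Sum.inl i)) u') (fun i => w (Sum.inr i))
      ∈ S.trajectories (k + L)}

/-- The two systems have the same input-output trajectories of every length. -/
def SameTrajectories {n m : ℕ} (S : SISOSystem n) (S' : SISOSystem m) : Prop :=
  ∀ k : ℕ, S.trajectories k = S'.trajectories k

/-- `(u, y)` is an input-output signal pair of the system on all times `t ≥ t₀`. -/
def IsSignalFrom {n : ℕ} (S : SISOSystem n) (t₀ : ℤ) (u y : ℤ → ℝ) : Prop :=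
  ∃ x : ℤ → Fin n → ℝ, ∀ t : ℤ, t₀ ≤ t → S.Step (x t) (u t) (x (t + 1)) (y t)

end SISOSystem

/-- Relative degree of a rational function: degree of the denominator minus degree of the
numerator, in lowest terms. -/
noncomputable def relativeDegree (G : RatFunc ℝ) : ℤ :=
  (G.denom.natDegree : ℤ) - (G.num.natDegree : ℤ)

namespace DataInversion

/-- The full data matrix `[U; Y]`, where `U = [Up; Uf]` has `N + 1` rows and `Y = [Yp; Yf]` has
`N + (L + 1)` rows. -/
def fullMatrix {N L T : ℕ} (U : Matrix (Fin (N + 1)) (Fin T) ℝ)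
    (Y : Matrix (Fin (N + 1 + L)) (Fin T) ℝ) :
    Matrix (Fin (N + 1) ⊕ Fin (N + 1 + L)) (Fin T) ℝ :=
  Matrix.fromRows U Y

/-- The first `N` rows of the input data. -/
def pastInput {N T : ℕ} (U : Matrix (Fin (N + 1)) (Fin T) ℝ) : Matrix (Fin N) (Fin T) ℝ :=
  U.submatrix Fin.castSucc id

/-- The last row of the input data. -/
def lastInput {N T : ℕ} (U : Matrix (Fin (N + 1)) (Fin T) ℝ) : Fin T → ℝ :=
  U (Fin.last N)

/-- The inversion data matrix `H_inv = [Up; Yp; Yf]`. -/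
def invMatrix {N L T : ℕ} (U : Matrix (Fin (N + 1)) (Fin T) ℝ)
    (Y : Matrix (Fin (N + 1 + L)) (Fin T) ℝ) : Matrix (Fin N ⊕ Fin (N + 1 + L)) (Fin T) ℝ :=
  Matrix.fromRows (pastInput U) Y

/-- The right-hand side at time `t`: the estimates `uhat(t-N-L), …, uhat(t-1-L)` followed by the
outputs `y(t-N-L), …, y(t)`. -/
def window (N L : ℕ) (uhat y : ℤ → ℝ) (t : ℤ) : Fin N ⊕ Fin (N + 1 + L) → ℝ :=
  Sum.elim (fun i => uhat (t - N - L + (i : ℕ))) (fun i => y (t - N - L + (i : ℕ)))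

/-- `g` is a solution of `H_inv g = col(uhat(t-N-L : t-1-L), y(t-N-L : t))`. -/
def Solves {N L T : ℕ} (U : Matrix (Fin (N + 1)) (Fin T) ℝ)
    (Y : Matrix (Fin (N + 1 + L)) (Fin T) ℝ) (uhat y : ℤ → ℝ) (t : ℤ) (g : Fin T → ℝ) : Prop :=
  Matrix.mulVec (invMatrix U Y) g = window N L uhat y t

/-- The algorithm is executed at time `t`: `uhat(t - L) = Uf g` for some solution `g`. -/
def Executes {N L T : ℕ} (U : Matrix (Fin (N + 1)) (Fin T) ℝ)
    (Y : Matrix (Fin (N + 1 + L)) (Fin T) ℝ) (uhat y : ℤ → ℝ) (t : ℤ) : Prop :=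
  ∃ g : Fin T → ℝ, Solves U Y uhat y t g ∧ uhat (t - L) = dotProduct (lastInput U) g

end DataInversion

/-! Let `L = M + ν`. The relative degree `ν` is the index of the first nonzero Markov parameter, so
output `i` depends only on the initial state and the inputs with index at most `i - ν`. Conversely,
if all outputs and the first `N` inputs vanish, the first `N` outputs are free responses, so
observability kills the state; the output at time `j + ν` then gives `u j = 0` recursively
(`eq_zero_of_response_eq_zero`). Hence the initial state and the first `N + 1 + M` inputs
parametrize `W_{N+1}^L` bijectively, which gives its dimension `n + N + 1 + M`, and forgetting the
last input is injective on it. So `H_inv` has the rank of the full data matrix, whose image lies in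
`W_{N+1}^L`; the rank condition says that the two spaces coincide. The algorithm is then exact by
induction: the true window lies in the image, and any solution reproduces its last input. -/

namespace SISOSystem

/-! ### Markov parameters and behaviour at infinity -/

open WithZero

/-- The Markov parameters `D, C B, C A B, C A² B, …`. -/
def markov {n : ℕ} (S : SISOSystem n) : ℕ → ℝ
  | 0 => S.D
  | k + 1 => S.C ⬝ᵥ ((S.A ^ k).mulVec S.B)

/-- The vector `(z I - A)⁻¹ B` of rational functions. -/
noncomputable def resolventVec {n : ℕ} (S : SISOSystem n) : Fin n → RatFunc ℝ :=
  ((RatFunc.X : RatFunc ℝ) • (1 : Matrix (Fin n) (Fin n) (RatFunc ℝ))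
    - S.A.map (fun a => RatFunc.C a))⁻¹.mulVec (fun i => RatFunc.C (S.B i))

/-- The rational function `C Aᵏ (z I - A)⁻¹ B`. -/
noncomputable def transferTail {n : ℕ} (S : SISOSystem n) (k : ℕ) : RatFunc ℝ :=
  (fun i => RatFunc.C (S.C i)) ⬝ᵥ ((S.A ^ k).map RatFunc.C).mulVec S.resolventVec

theorem isUnit_det_X_sub {n : ℕ} (A : Matrix (Fin n) (Fin n) ℝ) :
    IsUnit ((RatFunc.X : RatFunc ℝ) • (1 : Matrix (Fin n) (Fin n) (RatFunc ℝ))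
      - A.map (fun a => RatFunc.C a)).det := by
  have h : (RatFunc.X : RatFunc ℝ) • (1 : Matrix (Fin n) (Fin n) (RatFunc ℝ))
      - A.map (fun a => RatFunc.C a)
      = (algebraMap (Polynomial ℝ) (RatFunc ℝ)).mapMatrix A.charmatrix := by
    ext i j
    by_cases hij : i = j
    · subst hij
      simp [Matrix.charmatrix_apply_eq]
    · simp [hij]
  rw [h, ← RingHom.map_det, isUnit_iff_ne_zero]
  have := (Matrix.charpoly_monic A).ne_zero
  rw [Matrix.charpoly] at this
  simpa using this

theorem X_smul_resolventVec {n : ℕ} (S : SISOSystem n) :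
    (RatFunc.X : RatFunc ℝ) • S.resolventVec
      = (S.A.map RatFunc.C).mulVec S.resolventVec + fun i => RatFunc.C (S.B i) := by
  have h := Matrix.mul_nonsing_inv _ (isUnit_det_X_sub S.A)
  have h2 := congrArg (fun M => M.mulVec (fun i => RatFunc.C (S.B i))) h
  simp only [← Matrix.mulVec_mulVec, Matrix.one_mulVec] at h2
  rw [Matrix.sub_mulVec, Matrix.smul_mulVec, Matrix.one_mulVec, sub_eq_iff_eq_add'] at h2
  exact h2

theorem transferFunction_eq {n : ℕ} (S : SISOSystem n) :
    S.transferFunction = RatFunc.C (S.markov 0) + S.transferTail 0 := by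
  simp [transferFunction, transferTail, resolventVec, markov, add_comm]

/-- Multiplying by `X` peels off the next coefficient of the Laurent expansion at infinity. -/
theorem X_mul_transferTail {n : ℕ} (S : SISOSystem n) (k : ℕ) :
    RatFunc.X * S.transferTail k = RatFunc.C (S.markov (k + 1)) + S.transferTail (k + 1) := by
  have hB : ((S.A ^ k).map RatFunc.C).mulVec (fun i => RatFunc.C (S.B i))
      = fun i => RatFunc.C ((S.A ^ k).mulVec S.B i) := by
    ext i
    exact (RingHom.map_mulVec RatFunc.C (S.A ^ k) S.B i).symm
  have hm : RatFunc.C (S.markov (k + 1))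
      = (fun i => RatFunc.C (S.C i)) ⬝ᵥ fun i => RatFunc.C ((S.A ^ k).mulVec S.B i) :=
    RingHom.map_dotProduct RatFunc.C _ _
  rw [transferTail, ← smul_eq_mul, ← dotProduct_smul, ← Matrix.mulVec_smul,
    X_smul_resolventVec, Matrix.mulVec_add, dotProduct_add, Matrix.mulVec_mulVec, hB, ← hm,
    add_comm, transferTail, pow_succ, Matrix.map_mul]

open Classical in
theorem inftyValuation_C_le (a : ℝ) : RatFunc.inftyValuation ℝ (RatFunc.C a) ≤ 1 := by
  by_cases ha : a = 0
  · simp [ha]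
  · rw [RatFunc.inftyValuation.C ℝ ha]

open Classical in
theorem inftyValuation_dotProduct_C_lt {n : ℕ} (c : Fin n → ℝ) (w : Fin n → RatFunc ℝ)
    (γ : ℤᵐ⁰) (hγ : γ ≠ 0) (hw : ∀ i, RatFunc.inftyValuation ℝ (w i) < γ) :
    RatFunc.inftyValuation ℝ ((fun i => RatFunc.C (c i)) ⬝ᵥ w) < γ := by
  refine Valuation.map_sum_lt _ hγ fun i _ => ?_
  rw [map_mul]
  exact (mul_le_of_le_one_left' (inftyValuation_C_le _)).trans_lt (hw i)

-- The vector `v = (X I - A)⁻¹ B` satisfies `X v = A v + B`. If its largest entry had valuation at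
-- least 1, multiplying by `X` would strictly increase that valuation, while the right side cannot
-- exceed it.
open Classical in
theorem inftyValuation_resolventVec_lt {n : ℕ} (S : SISOSystem n) (i : Fin n) :
    RatFunc.inftyValuation ℝ (S.resolventVec i) < 1 := by
  have : Nonempty (Fin n) := ⟨i⟩
  obtain ⟨j, hj⟩ := Finite.exists_max fun i => RatFunc.inftyValuation ℝ (S.resolventVec i)
  refine (hj i).trans_lt (not_le.mp fun h1 => ?_)
  have hne : RatFunc.inftyValuation ℝ (S.resolventVec j) ≠ 0 := (zero_lt_one.trans_le h1).ne'
  have h := congrArg (RatFunc.inftyValuation ℝ) (congrFun (X_smul_resolventVec S) j)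
  rw [Pi.smul_apply, smul_eq_mul, map_mul, RatFunc.inftyValuation.X] at h
  have hle : exp 1 * RatFunc.inftyValuation ℝ (S.resolventVec j)
      ≤ RatFunc.inftyValuation ℝ (S.resolventVec j) := by
    rw [h, Pi.add_apply]
    refine Valuation.map_add_le _ ?_ ((inftyValuation_C_le _).trans h1)
    rw [Matrix.mulVec, dotProduct]
    refine Valuation.map_sum_le _ fun k _ => ?_
    rw [map_mul]
    exact (mul_le_of_le_one_left' (inftyValuation_C_le _)).trans (hj k)
  have hlt : (1 : ℤᵐ⁰) < exp 1 := by rw [← exp_zero, exp_lt_exp]; norm_num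
  have := mul_lt_mul_of_pos_right hlt (zero_lt_iff.mpr hne)
  rw [one_mul] at this
  exact absurd hle (not_le.mpr this)

open Classical in
theorem inftyValuation_transferTail_lt {n : ℕ} (S : SISOSystem n) (k : ℕ) :
    RatFunc.inftyValuation ℝ (S.transferTail k) < 1 :=
  inftyValuation_dotProduct_C_lt _ _ _ one_ne_zero fun i =>
    inftyValuation_dotProduct_C_lt (fun j => (S.A ^ k) i j) _ _ one_ne_zero
      fun j => S.inftyValuation_resolventVec_lt j

open Classical in
/-- A rational function that stays bounded at infinity under multiplication by every power of `X`
is zero. -/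
theorem eq_zero_of_inftyValuation_X_pow_mul_le (f : RatFunc ℝ)
    (h : ∀ k : ℕ, RatFunc.inftyValuation ℝ (RatFunc.X ^ k * f) ≤ 1) : f = 0 := by
  by_contra hf
  -- This power raises the degree of the product to at least 1.
  have h1 := h ((1 - f.intDegree).toNat)
  rw [map_mul, map_pow, RatFunc.inftyValuation.X, RatFunc.inftyValuation_apply,
    RatFunc.inftyValuation_of_nonzero ℝ hf, ← exp_nsmul, ← exp_add, ← exp_zero, exp_le_exp] at h1
  simp only [nsmul_eq_mul, mul_one] at h1
  omega

/-- After any number of multiplications by `X`, the difference of the tails is still strictly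
proper, so it is zero. -/
theorem transferFunction_eq_of_markov_eq {n m : ℕ} (S : SISOSystem n) (S' : SISOSystem m)
    (h : S.markov = S'.markov) : S.transferFunction = S'.transferFunction := by
  classical
  rw [transferFunction_eq, transferFunction_eq, h]
  congr 1
  rw [← sub_eq_zero]
  have hk : ∀ k : ℕ, RatFunc.X ^ k * (S.transferTail 0 - S'.transferTail 0)
      = S.transferTail k - S'.transferTail k := by
    intro k
    induction k with
    | zero => simp
    | succ k ih =>
      rw [pow_succ', mul_assoc, ih, mul_sub, X_mul_transferTail, X_mul_transferTail, h]
      ring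
  refine eq_zero_of_inftyValuation_X_pow_mul_le _ fun k => ?_
  rw [hk]
  exact Valuation.map_sub_le _ (S.inftyValuation_transferTail_lt k).le
    (S'.inftyValuation_transferTail_lt k).le

theorem X_pow_mul_transferFunction {n : ℕ} (S : SISOSystem n) (k : ℕ)
    (h : ∀ j < k, S.markov j = 0) :
    RatFunc.X ^ k * S.transferFunction = RatFunc.C (S.markov k) + S.transferTail k := by
  induction k with
  | zero => rw [pow_zero, one_mul, transferFunction_eq]
  | succ k ih =>
    rw [pow_succ', mul_assoc, ih fun j hj => h j (by omega), h k (by omega), map_zero, zero_add,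
      X_mul_transferTail]

/-- The relative degree of a nonzero transfer function is the index of its first nonzero Markov
parameter. -/
theorem exists_relativeDegree_eq {n : ℕ} (S : SISOSystem n) (hG : S.transferFunction ≠ 0) :
    ∃ ν : ℕ, relativeDegree S.transferFunction = ν ∧ S.markov ν ≠ 0 ∧
      ∀ j < ν, S.markov j = 0 := by
  classical
  have hex : ∃ ν, S.markov ν ≠ 0 := by
    by_contra! h
    refine hG (eq_zero_of_inftyValuation_X_pow_mul_le _ fun k => ?_)
    rw [X_pow_mul_transferFunction S k fun j _ => h j, h k, map_zero, zero_add]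
    exact (S.inftyValuation_transferTail_lt k).le
  have hlow : ∀ j < Nat.find hex, S.markov j = 0 := fun j hj => not_not.mp (Nat.find_min hex hj)
  refine ⟨Nat.find hex, ?_, Nat.find_spec hex, hlow⟩
  -- The nonzero constant dominates the strictly proper tail, so `X ^ ν * G` has degree 0.
  have hv := congrArg (RatFunc.inftyValuation ℝ) (X_pow_mul_transferFunction S _ hlow)
  rw [Valuation.map_add_eq_of_lt_left _ (by
      rw [RatFunc.inftyValuation.C ℝ (Nat.find_spec hex)]
      exact S.inftyValuation_transferTail_lt _),
    RatFunc.inftyValuation.C ℝ (Nat.find_spec hex), map_mul, map_pow, RatFunc.inftyValuation.X,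
    RatFunc.inftyValuation_apply, RatFunc.inftyValuation_of_nonzero ℝ hG, ← exp_nsmul, ← exp_add,
    ← exp_zero, exp_inj, RatFunc.intDegree] at hv
  simp only [nsmul_eq_mul, mul_one] at hv
  rw [relativeDegree]
  omega

end SISOSystem

/-! ### Minimality and observability -/

namespace SISOSystem

/-- A linear system on an abstract finite-dimensional state space has a matrix realization. -/
theorem exists_markov_eq {V : Type*} [AddCommGroup V] [Module ℝ V] [FiniteDimensional ℝ V]
    (a : V →ₗ[ℝ] V) (b : V) (c : V →ₗ[ℝ] ℝ) (d : ℝ) :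
    ∃ S : SISOSystem (Module.finrank ℝ V), S.markov 0 = d ∧
      ∀ k, S.markov (k + 1) = c ((a ^ k) b) := by
  let e := Module.finBasis ℝ V
  refine ⟨⟨LinearMap.toMatrix e e a, e.repr b, fun i => c (e i), d⟩, rfl, fun k => ?_⟩
  have h : (LinearMap.toMatrix e e a ^ k).mulVec (e.repr b) = e.repr ((a ^ k) b) := by
    rw [LinearMap.toMatrix_pow, LinearMap.toMatrix_mulVec_repr]
  rw [markov, h]
  conv_rhs => rw [← e.sum_repr ((a ^ k) b)]
  rw [map_sum]
  exact Finset.sum_congr rfl fun i _ => by simp [mul_comm]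

/-- A state that is not seen by the first `n` outputs is never seen. -/
theorem dotProduct_pow_mulVec_eq_zero {n : ℕ} (S : SISOSystem n) (x : Fin n → ℝ)
    (h : ∀ i < n, S.C ⬝ᵥ (S.A ^ i).mulVec x = 0) (k : ℕ) :
    S.C ⬝ᵥ (S.A ^ k).mulVec x = 0 := by
  rcases Nat.eq_zero_or_pos n with rfl | hn
  · simp [dotProduct]
  -- Cayley–Hamilton: `A ^ k` is a combination of powers below `n`.
  rw [Matrix.pow_eq_aeval_mod_charpoly, Polynomial.aeval_eq_sum_range' (n := n),
    Matrix.sum_mulVec, dotProduct_sum]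
  · refine Finset.sum_eq_zero fun i hi => ?_
    rw [Matrix.smul_mulVec, dotProduct_smul, h i (Finset.mem_range.mp hi), smul_zero]
  · have := Polynomial.natDegree_modByMonic_lt (Polynomial.X ^ k) (Matrix.charpoly_monic S.A)
      (fun h1 => by
        have := Matrix.charpoly_natDegree_eq_dim S.A
        rw [h1, Polynomial.natDegree_one, Fintype.card_fin] at this
        omega)
    rwa [Matrix.charpoly_natDegree_eq_dim, Fintype.card_fin] at this

/-- Minimal realizations are observable. -/
theorem IsMinimal.eq_zero_of_dotProduct_eq_zero {n : ℕ} {S : SISOSystem n} (hS : S.IsMinimal)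
    (x : Fin n → ℝ) (h : ∀ i < n, S.C ⬝ᵥ (S.A ^ i).mulVec x = 0) : x = 0 := by
  by_contra hx
  let a : (Fin n → ℝ) →ₗ[ℝ] (Fin n → ℝ) := Matrix.toLin' S.A
  let c : (Fin n → ℝ) →ₗ[ℝ] ℝ := dotProductBilin ℝ ℝ S.C
  have ha : ∀ k v, (a ^ k) v = (S.A ^ k).mulVec v := fun k v => by
    rw [← Matrix.toLin'_pow, Matrix.toLin'_apply]
  -- The unobservable subspace. Passing to the quotient by it keeps all Markov parameters, so a
  -- nonzero `K` would contradict minimality.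
  let K : Submodule ℝ (Fin n → ℝ) := ⨅ k : ℕ, LinearMap.ker (c ∘ₗ a ^ k)
  have hK : ∀ v, v ∈ K ↔ ∀ k, c ((a ^ k) v) = 0 := fun v => by
    simp [K, Submodule.mem_iInf]
  have hxK : x ∈ K := (hK x).mpr fun k => by
    rw [ha]; exact S.dotProduct_pow_mulVec_eq_zero x h k
  have hcK : K ≤ LinearMap.ker c := fun v hv => by
    simpa using (hK v).mp hv 0
  have haK : K ≤ K.comap a := fun v hv => by
    rw [Submodule.mem_comap, hK]
    intro k
    have := (hK v).mp hv (k + 1)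
    rwa [pow_succ] at this
  obtain ⟨S', h0, h1⟩ := exists_markov_eq (K.mapQ K a haK) (K.mkQ S.B) (K.liftQ c hcK) S.D
  have hpow : ∀ k, ((K.mapQ K a haK) ^ k) (K.mkQ S.B) = K.mkQ ((a ^ k) S.B) := by
    intro k
    induction k with
    | zero => rfl
    | succ k ih =>
      rw [pow_succ', pow_succ', Module.End.mul_apply, Module.End.mul_apply, ih]
      rfl
  have hm : S'.markov = S.markov := by
    funext k
    cases k with
    | zero => exact h0
    | succ k =>
      rw [h1, hpow, ha]
      rfl
  have hle := hS _ S' (transferFunction_eq_of_markov_eq _ _ hm)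
  have hpos : 0 < Module.finrank ℝ K :=
    Module.finrank_pos_iff_exists_ne_zero.mpr ⟨⟨x, hxK⟩, fun h0 => hx (congrArg Subtype.val h0)⟩
  have := K.finrank_quotient_add_finrank
  rw [Module.finrank_fin_fun] at this
  omega

theorem obsMatrix_mulVec {n : ℕ} (S : SISOSystem n) (k : ℕ) (x : Fin n → ℝ) (i : Fin k) :
    (S.obsMatrix k).mulVec x i = S.C ⬝ᵥ (S.A ^ (i : ℕ)).mulVec x := by
  rw [Matrix.dotProduct_mulVec]
  rfl

/-- A state of a minimal realization is determined by as many free outputs as the observability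
index. -/
theorem IsMinimal.eq_zero_of_obsIndex_le {n : ℕ} {S : SISOSystem n} (hS : S.IsMinimal) {N : ℕ}
    (hN : S.obsIndex ≤ N) (x : Fin n → ℝ)
    (h : ∀ i < N, S.C ⬝ᵥ (S.A ^ i).mulVec x = 0) : x = 0 := by
  have hrank : (S.obsMatrix S.obsIndex).rank = (S.obsMatrix n).rank :=
    Nat.sInf_mem (s := {k | (S.obsMatrix k).rank = (S.obsMatrix n).rank}) ⟨n, rfl⟩
  have hn : LinearMap.ker (S.obsMatrix n).mulVecLin = ⊥ := by
    refine LinearMap.ker_eq_bot'.mpr fun v hv => hS.eq_zero_of_dotProduct_eq_zero v fun i hi => ?_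
    have := congrFun hv ⟨i, hi⟩
    rwa [Matrix.mulVecLin_apply, obsMatrix_mulVec] at this
  have e1 := (S.obsMatrix n).mulVecLin.finrank_range_add_finrank_ker
  have e2 := (S.obsMatrix S.obsIndex).mulVecLin.finrank_range_add_finrank_ker
  rw [hn, finrank_bot] at e1
  rw [Matrix.rank, Matrix.rank] at hrank
  have hker : LinearMap.ker (S.obsMatrix S.obsIndex).mulVecLin = ⊥ :=
    Submodule.finrank_eq_zero.mp (by omega)
  refine LinearMap.ker_eq_bot'.mp hker x (funext fun i => ?_)
  rw [Matrix.mulVecLin_apply, obsMatrix_mulVec]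
  exact h i (i.2.trans_le hN)

end SISOSystem

/-! ### Responses, delayed inversion and the dimension of `W_k^L` -/

namespace SISOSystem

/-- The states reached from the initial state `x₀` under the input `u`. -/
def run {n : ℕ} (S : SISOSystem n) (x₀ : Fin n → ℝ) (u : ℕ → ℝ) : ℕ → Fin n → ℝ
  | 0 => x₀
  | i + 1 => S.A.mulVec (S.run x₀ u i) + u i • S.B

/-- The output at time `i` from the initial state `x₀` under the input `u`. -/
def response {n : ℕ} (S : SISOSystem n) (x₀ : Fin n → ℝ) (u : ℕ → ℝ) (i : ℕ) : ℝ :=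
  S.C ⬝ᵥ (S.A ^ i).mulVec x₀ + ∑ j ∈ Finset.range (i + 1), S.markov (i - j) * u j

/-- The power `m` is kept general because the induction on `i` trades each time step for one more
factor `A`. -/
theorem dotProduct_pow_mulVec_run {n : ℕ} (S : SISOSystem n) (x₀ : Fin n → ℝ) (u : ℕ → ℝ)
    (i m : ℕ) :
    S.C ⬝ᵥ (S.A ^ m).mulVec (S.run x₀ u i)
      = S.C ⬝ᵥ (S.A ^ (m + i)).mulVec x₀
        + ∑ j ∈ Finset.range i, S.markov (m + i - j) * u j := by
  induction i generalizing m with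
  | zero => simp [run]
  | succ i ih =>
    rw [run, Matrix.mulVec_add, dotProduct_add, Matrix.mulVec_mulVec, ← pow_succ, ih,
      Finset.sum_range_succ, Matrix.mulVec_smul, dotProduct_smul,
      show m + (i + 1) - i = m + 1 by omega, show m + 1 + i = m + (i + 1) by omega, markov,
      smul_eq_mul]
    ring

theorem dotProduct_run_add {n : ℕ} (S : SISOSystem n) (x₀ : Fin n → ℝ) (u : ℕ → ℝ) (i : ℕ) :
    S.C ⬝ᵥ S.run x₀ u i + S.D * u i = S.response x₀ u i := by
  have h := S.dotProduct_pow_mulVec_run x₀ u i 0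
  rw [pow_zero, Matrix.one_mulVec, zero_add] at h
  rw [h, response, Finset.sum_range_succ, Nat.sub_self, markov]
  ring

theorem mem_trajectories_iff {n : ℕ} (S : SISOSystem n) (k : ℕ) (w : Fin k ⊕ Fin k → ℝ) :
    w ∈ S.trajectories k ↔ ∃ (x₀ : Fin n → ℝ) (u : ℕ → ℝ), ∀ i : Fin k,
      w (Sum.inl i) = u i ∧ w (Sum.inr i) = S.response x₀ u i := by
  constructor
  · rintro ⟨x, hx⟩
    let u : ℕ → ℝ := fun j => if h : j < k then w (Sum.inl ⟨j, h⟩) else 0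
    have hu : ∀ i : Fin k, w (Sum.inl i) = u i := fun i => by simp [u]
    have hrun : ∀ i ≤ k, x i = S.run (x 0) u i := by
      intro i hi
      induction i with
      | zero => rfl
      | succ i ih => rw [(hx ⟨i, hi⟩).1, ih (by omega), run, hu]
    refine ⟨x 0, u, fun i => ⟨hu i, ?_⟩⟩
    rw [(hx i).2, ← dotProduct_run_add, hrun i i.2.le, hu]
  · rintro ⟨x₀, u, h⟩
    refine ⟨S.run x₀ u, fun i => ⟨?_, ?_⟩⟩
    · rw [(h i).1, run]
    · rw [(h i).1, (h i).2, dotProduct_run_add]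

theorem mem_delayTrajectories_iff {n : ℕ} (S : SISOSystem n) (k L : ℕ)
    (w : Fin k ⊕ Fin (k + L) → ℝ) :
    w ∈ S.delayTrajectories k L ↔ ∃ (x₀ : Fin n → ℝ) (u : ℕ → ℝ),
      (∀ i : Fin k, w (Sum.inl i) = u i) ∧
        ∀ i : Fin (k + L), w (Sum.inr i) = S.response x₀ u i := by
  constructor
  · rintro ⟨u', h⟩
    obtain ⟨x₀, u, h⟩ := (S.mem_trajectories_iff _ _).mp h
    exact ⟨x₀, u, fun i => by simpa using (h (Fin.castAdd L i)).1, fun i => (h i).2⟩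
  · rintro ⟨x₀, u, h1, h2⟩
    refine ⟨fun j => u (k + j), (S.mem_trajectories_iff _ _).mpr ⟨x₀, u, fun i => ⟨?_, h2 i⟩⟩⟩
    refine Fin.addCases (fun j => ?_) (fun j => ?_) i
    · simpa using h1 j
    · simp

theorem response_add {n : ℕ} (S : SISOSystem n) (x x' : Fin n → ℝ) (u u' : ℕ → ℝ) (i : ℕ) :
    S.response (x + x') (u + u') i = S.response x u i + S.response x' u' i := by
  simp only [response, Matrix.mulVec_add, dotProduct_add, Pi.add_apply, mul_add,
    Finset.sum_add_distrib]
  ring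

theorem response_smul {n : ℕ} (S : SISOSystem n) (r : ℝ) (x : Fin n → ℝ) (u : ℕ → ℝ) (i : ℕ) :
    S.response (r • x) (r • u) i = r * S.response x u i := by
  simp only [response, Matrix.mulVec_smul, dotProduct_smul, Pi.smul_apply, smul_eq_mul, mul_add,
    Finset.mul_sum]
  congr 1
  exact Finset.sum_congr rfl fun j _ => by ring

theorem response_congr {n : ℕ} (S : SISOSystem n) {ν : ℕ} (hν : ∀ j < ν, S.markov j = 0)
    (x : Fin n → ℝ) {u u' : ℕ → ℝ} {i : ℕ} (h : ∀ j, j + ν ≤ i → u j = u' j) :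
    S.response x u i = S.response x u' i := by
  rw [response, response]
  congr 1
  refine Finset.sum_congr rfl fun j hj => ?_
  rw [Finset.mem_range] at hj
  by_cases hji : j + ν ≤ i
  · rw [h j hji]
  · rw [hν (i - j) (by omega), zero_mul, zero_mul]

/-- Left invertibility with delay `ν`: vanishing outputs together with vanishing inputs over one
observability window force the initial state and the inputs to vanish. -/
theorem eq_zero_of_response_eq_zero {n : ℕ} (S : SISOSystem n) {ν N K : ℕ}
    (hν : ∀ j < ν, S.markov j = 0) (hν0 : S.markov ν ≠ 0)
    (hobs : ∀ x : Fin n → ℝ, (∀ i < N, S.C ⬝ᵥ (S.A ^ i).mulVec x = 0) → x = 0) (hNK : N ≤ K)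
    (x : Fin n → ℝ) (u : ℕ → ℝ) (hu : ∀ i < N, u i = 0) (hy : ∀ i < K, S.response x u i = 0) :
    x = 0 ∧ ∀ j, j + ν < K → u j = 0 := by
  have hx : x = 0 := hobs x fun i hi => by
    have h := hy i (hi.trans_le hNK)
    rw [response, Finset.sum_eq_zero, add_zero] at h
    · exact h
    · intro j hj
      rw [Finset.mem_range] at hj
      rw [hu j (by omega), mul_zero]
  refine ⟨hx, fun j => ?_⟩
  induction j using Nat.strong_induction_on with
  | _ j ih =>
    intro hj
    have h := hy _ hj
    rw [response, hx, Matrix.mulVec_zero, dotProduct_zero, zero_add,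
      Finset.sum_eq_single j, Nat.add_sub_cancel_left] at h
    · exact (mul_eq_zero.mp h).resolve_left hν0
    · intro b hb hbj
      rw [Finset.mem_range] at hb
      -- In the output at time `j + ν`, earlier inputs vanish by induction and later ones meet zero
      -- Markov parameters.
      rcases lt_or_gt_of_ne hbj with hlt | hgt
      · rw [ih b hlt (by omega), mul_zero]
      · rw [hν _ (by omega), zero_mul]
    · intro hnot
      exact absurd (Finset.mem_range.mpr (by omega)) hnot

/-- Extension of a finite signal by zero. -/
def extendZero (p : ℕ) : (Fin p → ℝ) →ₗ[ℝ] (ℕ → ℝ) where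
  toFun u j := if h : j < p then u ⟨j, h⟩ else 0
  map_add' u u' := by
    funext j
    by_cases h : j < p <;> simp [h]
  map_smul' r u := by
    funext j
    by_cases h : j < p <;> simp [h]

theorem extendZero_apply_of_lt {p : ℕ} (u : Fin p → ℝ) {j : ℕ} (h : j < p) :
    extendZero p u j = u ⟨j, h⟩ :=
  dif_pos h

/-- Parametrization of `W_k^L` by the initial state and the first `p` inputs. -/
def delayMap {n : ℕ} (S : SISOSystem n) (k L p : ℕ) :
    ((Fin n → ℝ) × (Fin p → ℝ)) →ₗ[ℝ] (Fin k ⊕ Fin (k + L) → ℝ) where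
  toFun q := Sum.elim (fun i => extendZero p q.2 i)
    (fun i => S.response q.1 (extendZero p q.2) i)
  map_add' q q' := by
    funext i
    cases i <;> simp [response_add]
  map_smul' r q := by
    funext i
    cases i <;> simp [response_smul]

/-- Inputs with index at least `k + M` cannot reach the outputs before time `k + M + ν`, so
replacing them by zero loses no trajectory. -/
theorem coe_range_delayMap {n : ℕ} (S : SISOSystem n) {ν M : ℕ}
    (hν : ∀ j < ν, S.markov j = 0) (k : ℕ) :
    (LinearMap.range (S.delayMap k (M + ν) (k + M)) : Set (Fin k ⊕ Fin (k + (M + ν)) → ℝ))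
      = S.delayTrajectories k (M + ν) := by
  ext w
  rw [mem_delayTrajectories_iff, SetLike.mem_coe, LinearMap.mem_range]
  constructor
  · rintro ⟨q, rfl⟩
    exact ⟨q.1, extendZero _ q.2, fun i => rfl, fun i => rfl⟩
  · rintro ⟨x, u, h1, h2⟩
    refine ⟨(x, fun j => u j), funext fun i => ?_⟩
    cases i with
    | inl i => rw [h1]; exact extendZero_apply_of_lt _ (by omega)
    | inr i =>
      rw [h2]
      exact S.response_congr hν x fun j hj => extendZero_apply_of_lt _ (by omega)

theorem delayMap_injective {n : ℕ} (S : SISOSystem n) {ν N M k : ℕ}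
    (hν : ∀ j < ν, S.markov j = 0) (hν0 : S.markov ν ≠ 0)
    (hobs : ∀ x : Fin n → ℝ, (∀ i < N, S.C ⬝ᵥ (S.A ^ i).mulVec x = 0) → x = 0) (hNk : N ≤ k) :
    Function.Injective (S.delayMap k (M + ν) (k + M)) := by
  rw [injective_iff_map_eq_zero]
  rintro ⟨x, u⟩ h
  obtain ⟨hx, hu⟩ := S.eq_zero_of_response_eq_zero (K := k + (M + ν)) hν hν0 hobs (by omega) x
    (extendZero (k + M) u) (fun i hi => congrFun h (Sum.inl ⟨i, by omega⟩))
    (fun i hi => congrFun h (Sum.inr ⟨i, hi⟩))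
  refine Prod.ext hx (funext fun j => ?_)
  have := hu j (by omega)
  rwa [extendZero_apply_of_lt _ j.2] at this

theorem finrank_range_delayMap {n : ℕ} (S : SISOSystem n) {ν N M k : ℕ}
    (hν : ∀ j < ν, S.markov j = 0) (hν0 : S.markov ν ≠ 0)
    (hobs : ∀ x : Fin n → ℝ, (∀ i < N, S.C ⬝ᵥ (S.A ^ i).mulVec x = 0) → x = 0) (hNk : N ≤ k) :
    Module.finrank ℝ (LinearMap.range (S.delayMap k (M + ν) (k + M))) = n + (k + M) := by
  rw [LinearMap.finrank_range_of_inj (S.delayMap_injective hν hν0 hobs hNk)]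
  simp

/-- A signal pair restricted to a window of length `k + L` lies in `W_k^L`. -/
theorem IsSignalFrom.window_mem {n : ℕ} {S : SISOSystem n} {t₀ : ℤ} {u y : ℤ → ℝ}
    (h : S.IsSignalFrom t₀ u y) (k L : ℕ) {s : ℤ} (hs : t₀ ≤ s) :
    Sum.elim (fun i : Fin k => u (s + (i : ℕ))) (fun i : Fin (k + L) => y (s + (i : ℕ)))
      ∈ S.delayTrajectories k L := by
  obtain ⟨x, hx⟩ := h
  refine ⟨fun j => u (s + (k + (j : ℕ) : ℕ)), fun i => x (s + i), fun i => ?_⟩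
  have hu : Fin.append (fun i : Fin k => u (s + (i : ℕ)))
      (fun j : Fin L => u (s + (k + (j : ℕ) : ℕ))) i = u (s + (i : ℕ)) := by
    refine Fin.addCases (fun j => ?_) (fun j => ?_) i
    · simp
    · simp
  have := hx (s + (i : ℕ)) (by omega)
  simp only [Sum.elim_inl, Sum.elim_inr]
  rw [hu, Nat.cast_add, Nat.cast_one, ← add_assoc]
  exact this

end SISOSystem

/-! ### Data matrices and the inversion algorithm -/

namespace DataInversion

/-- The projection of `col(u, y)` that forgets the last input. -/
def forgetLast (N K : ℕ) : (Fin (N + 1) ⊕ Fin K → ℝ) →ₗ[ℝ] (Fin N ⊕ Fin K → ℝ) :=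
  LinearMap.funLeft ℝ ℝ (Sum.map Fin.castSucc id)

theorem invMatrix_mulVec {N L T : ℕ} (U : Matrix (Fin (N + 1)) (Fin T) ℝ)
    (Y : Matrix (Fin (N + 1 + L)) (Fin T) ℝ) (g : Fin T → ℝ) :
    (invMatrix U Y).mulVec g = forgetLast N _ ((fullMatrix U Y).mulVec g) := by
  funext i
  cases i <;> rfl

theorem range_invMatrix {N L T : ℕ} (U : Matrix (Fin (N + 1)) (Fin T) ℝ)
    (Y : Matrix (Fin (N + 1 + L)) (Fin T) ℝ) :
    LinearMap.range (invMatrix U Y).mulVecLin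
      = (LinearMap.range (fullMatrix U Y).mulVecLin).map (forgetLast N (N + 1 + L)) := by
  rw [← LinearMap.range_comp]
  congr 1
  exact LinearMap.ext fun g => invMatrix_mulVec U Y g

/-- On `W_{N+1}^L` the last input is determined by the other entries. -/
theorem eq_zero_of_forgetLast_eq_zero {n : ℕ} (S : SISOSystem n) {ν N M : ℕ}
    (hν : ∀ j < ν, S.markov j = 0) (hν0 : S.markov ν ≠ 0)
    (hobs : ∀ x : Fin n → ℝ, (∀ i < N, S.C ⬝ᵥ (S.A ^ i).mulVec x = 0) → x = 0)
    (w : Fin (N + 1) ⊕ Fin (N + 1 + (M + ν)) → ℝ)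
    (hw : w ∈ S.delayTrajectories (N + 1) (M + ν))
    (h0 : forgetLast N (N + 1 + (M + ν)) w = 0) : w = 0 := by
  obtain ⟨x, u, h1, h2⟩ := (S.mem_delayTrajectories_iff _ _ w).mp hw
  have hy : ∀ i, w (Sum.inr i) = 0 := fun i => congrFun h0 (Sum.inr i)
  obtain ⟨-, hu⟩ := S.eq_zero_of_response_eq_zero (K := N + 1 + (M + ν)) hν hν0 hobs (by omega) x u
    (fun i hi => (h1 ⟨i, by omega⟩).symm.trans (congrFun h0 (Sum.inl ⟨i, hi⟩)))
    (fun i hi => (h2 ⟨i, hi⟩).symm.trans (hy ⟨i, hi⟩))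
  funext i
  cases i with
  | inl i => rw [h1]; exact hu i (by omega)
  | inr i => exact hy i

end DataInversion

theorem proposition4
    -- a minimal realization `S₀` with `n` states and nonzero transfer function
    {n : ℕ} (S₀ : SISOSystem n) (hmin : S₀.IsMinimal) (hG : S₀.transferFunction ≠ 0)
    -- any, possibly non-minimal, state-space representation `S` of the same system
    {n' : ℕ} (S : SISOSystem n') (hS : S.SameTrajectories S₀)
    (N L T : ℕ) (hN : S₀.obsIndex ≤ N) (hL : relativeDegree S₀.transferFunction ≤ (L : ℤ))
    -- data matrices whose columns are trajectories of the system
    (U : Matrix (Fin (N + 1)) (Fin T) ℝ) (Y : Matrix (Fin (N + 1 + L)) (Fin T) ℝ)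
    (hdata : ∀ j : Fin T,
      (fun i => DataInversion.fullMatrix U Y i j) ∈ S.delayTrajectories (N + 1) L) :
    (Set.range (fun g : Fin T → ℝ => Matrix.mulVec (DataInversion.fullMatrix U Y) g)
        = S.delayTrajectories (N + 1) L
      ↔ ((DataInversion.invMatrix U Y).rank : ℤ)
        = (N : ℤ) + n + L - relativeDegree S₀.transferFunction + 1) ∧
    (((DataInversion.invMatrix U Y).rank : ℤ)
        = (N : ℤ) + n + L - relativeDegree S₀.transferFunction + 1 →
      ∀ u y uhat : ℤ → ℝ, S.IsSignalFrom (-(N : ℤ) - L) u y →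
        (∀ t : ℤ, -(N : ℤ) ≤ t → t ≤ -1 → uhat (t - L) = u (t - L)) →
        -- the algorithm never gets stuck
        (∀ t : ℤ, 0 ≤ t → (∀ s : ℤ, 0 ≤ s → s < t → DataInversion.Executes U Y uhat y s) →
          ∃ g : Fin T → ℝ, DataInversion.Solves U Y uhat y t g) ∧
        -- whatever solutions are chosen, its estimates are exact
        ((∀ t : ℤ, 0 ≤ t → DataInversion.Executes U Y uhat y t) →
          ∀ t : ℤ, 0 ≤ t → uhat (t - L) = u (t - L))) := by
  obtain ⟨ν, hνdeg, hν0, hν⟩ := S₀.exists_relativeDegree_eq hG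
  have hobs : ∀ x : Fin n → ℝ, (∀ i < N, S₀.C ⬝ᵥ (S₀.A ^ i).mulVec x = 0) → x = 0 :=
    hmin.eq_zero_of_obsIndex_le hN
  rw [hνdeg] at hL ⊢
  obtain ⟨M, rfl⟩ : ∃ M, L = M + ν := ⟨L - ν, by omega⟩
  have hW : S.delayTrajectories (N + 1) (M + ν) = S₀.delayTrajectories (N + 1) (M + ν) := by
    unfold SISOSystem.delayTrajectories
    rw [hS]
  set W := LinearMap.range (S₀.delayMap (N + 1) (M + ν) (N + 1 + M)) with hWdef
  have hWS : (W : Set _) = S₀.delayTrajectories (N + 1) (M + ν) := S₀.coe_range_delayMap hν _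
  have hWrank : Module.finrank ℝ W = n + (N + 1 + M) :=
    S₀.finrank_range_delayMap hν hν0 hobs (by omega)
  have hinj : ∀ w ∈ W, DataInversion.forgetLast N (N + 1 + (M + ν)) w = 0 → w = 0 :=
    fun w hw => DataInversion.eq_zero_of_forgetLast_eq_zero S₀ hν hν0 hobs w (hWS ▸ hw)
  set R := LinearMap.range (DataInversion.fullMatrix U Y).mulVecLin with hR
  have hRW : R ≤ W := by
    rw [hR, Matrix.range_mulVecLin, Submodule.span_le]
    rintro _ ⟨j, rfl⟩
    rw [hWS, ← hW]
    exact hdata j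
  -- Forgetting the last input is injective on `W`, hence on the column space `R`.
  have hrank : (DataInversion.invMatrix U Y).rank = Module.finrank ℝ R := by
    rw [Matrix.rank, DataInversion.range_invMatrix, ← hR]
    rw [← LinearMap.range_domRestrict]
    refine LinearMap.finrank_range_of_inj ((injective_iff_map_eq_zero _).mpr fun a ha => ?_)
    exact Subtype.ext (hinj a (hRW a.2) ha)
  have hset : Set.range (fun g : Fin T → ℝ => (DataInversion.fullMatrix U Y).mulVec g)
      = (R : Set _) := rfl
  have hrankeq : ((DataInversion.invMatrix U Y).rank : ℤ) = (N : ℤ) + n + (M + ν : ℕ) - ν + 1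
      ↔ R = W := by
    constructor
    · intro h
      refine Submodule.eq_of_le_of_finrank_eq hRW ?_
      push_cast at h
      omega
    · intro h
      rw [hrank, h, hWrank]
      push_cast
      ring
  rw [hset, hW, ← hWS, hrankeq, SetLike.coe_set_eq]
  refine ⟨Iff.rfl, fun hRWeq u y uhat hsig hinit => ?_⟩
  have hmem : ∀ t : ℤ, 0 ≤ t →
      Sum.elim (fun i : Fin (N + 1) => u (t - N - (M + ν : ℕ) + (i : ℕ)))
        (fun i : Fin (N + 1 + (M + ν)) => y (t - N - (M + ν : ℕ) + (i : ℕ))) ∈ W := by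
    intro t ht
    rw [← SetLike.mem_coe, hWS, ← hW]
    exact hsig.window_mem _ _ (by omega)
  have hwin : ∀ t : ℤ, (∀ s : ℤ, -(N : ℤ) ≤ s → s < t →
        uhat (s - (M + ν : ℕ)) = u (s - (M + ν : ℕ))) → 0 ≤ t →
      DataInversion.window N (M + ν) uhat y t
        = DataInversion.forgetLast N (N + 1 + (M + ν))
          (Sum.elim (fun i : Fin (N + 1) => u (t - N - (M + ν : ℕ) + (i : ℕ)))
            (fun i : Fin (N + 1 + (M + ν)) => y (t - N - (M + ν : ℕ) + (i : ℕ)))) := by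
    intro t hs ht
    funext i
    cases i with
    | inl i =>
      have := hs (t - N + (i : ℕ)) (by omega) (by omega)
      rw [show t - N + (i : ℕ) - ((M + ν : ℕ) : ℤ) = t - N - (M + ν : ℕ) + (i : ℕ) by ring] at this
      exact this
    | inr i => rfl
  have hstep : ∀ t : ℤ, 0 ≤ t → (∀ s : ℤ, -(N : ℤ) ≤ s → s < t →
        uhat (s - (M + ν : ℕ)) = u (s - (M + ν : ℕ))) →
      DataInversion.Executes U Y uhat y t → uhat (t - (M + ν : ℕ)) = u (t - (M + ν : ℕ)) := by
    rintro t ht hs ⟨g, hg, hug⟩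
    rw [DataInversion.Solves, hwin t hs ht, DataInversion.invMatrix_mulVec] at hg
    -- The data combination and the true window both lie in `W` and agree up to the last input,
    -- hence entirely.
    have hfull := sub_eq_zero.mp (hinj _ (W.sub_mem (hRW ⟨g, rfl⟩) (hmem t ht)) (by
      rw [map_sub, sub_eq_zero]; exact hg))
    have hlast := congrFun hfull (Sum.inl (Fin.last N))
    rw [hug]
    refine (Eq.trans ?_ hlast).trans ?_
    · rfl
    · simp only [Sum.elim_inl, Fin.val_last]
      congr 1
      ring
  have hexact : ∀ t : ℤ, (∀ s : ℤ, 0 ≤ s → s < t → DataInversion.Executes U Y uhat y s) →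
      ∀ s : ℤ, -(N : ℤ) ≤ s → s < t → uhat (s - (M + ν : ℕ)) = u (s - (M + ν : ℕ)) := by
    intro t hex
    -- Strong induction on integer times through a natural bound `m`; negative times are covered by
    -- the initialization.
    have key : ∀ m : ℕ, ∀ s : ℤ, -(N : ℤ) ≤ s → s < m → s < t →
        uhat (s - (M + ν : ℕ)) = u (s - (M + ν : ℕ)) := by
      intro m
      induction m with
      | zero => exact fun s h1 h2 _ => hinit s h1 (by omega)
      | succ m ih =>
        intro s h1 h2 h3
        rcases lt_or_ge s m with h | h
        · exact ih s h1 h h3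
        · exact hstep s (by omega) (fun r hr1 hr2 => ih r hr1 (by omega) (by omega))
            (hex s (by omega) h3)
    exact fun s h1 h2 => key (s + 1).toNat s h1 (by omega) h2
  refine ⟨fun t ht hex => ?_, fun hex t ht => ?_⟩
  · obtain ⟨g, hg⟩ : _ ∈ R := hRWeq ▸ hmem t ht
    refine ⟨g, ?_⟩
    rw [DataInversion.Solves, hwin t (hexact t hex) ht, DataInversion.invMatrix_mulVec, ← hg]
    rfl
  · exact hexact (t + 1) (fun s hs _ => hex s hs) t (by omega) (by omega)
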